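/- All manifolds and maps between them are smooth. Let $n\ge 0$, and let $V_n$ be the collection of pairs $(F\times[0,1],L)$, where $F$ is a compact $(n+1)$-manifold with possibly empty boundary and $L$ is a closed (compact, without boundary) $n$-dimensional submanifold of the interior of $F\times[0,1]$ that meets every connected component of $F\times[0,1]$. Write $(F_1\times[0,1],L_1)\sim(F_2\times[0,1],L_2)$ if there is an embedding $f:F_1\to F_2$ with $(f\times\mathrm{id}_{[0,1]})(L_1)=L_2$. Virtual equivalence is the equivalence relation on $V_n$ generated by $\sim$ together with isotopy of $L$, through embeddings into the interior of $F\times[0,1]$, with $F$ fixed. A virtual $n$-link is a virtual equivalence class $[F\times[0,1],L]$. Let $h(F)$ be the quotient of $F\times[0,1]$ obtained by identifying all points of $F\times\{1\}$ with one another (that is, $F\times[0,1]$ with a cone glued on $F\times\{1\}$). Theorem 19. (1) If two pairs $(F\times[0,1],L)$ and $(F'\times[0,1],L')$ in $V_n$ are virtually equivalent, then $h(F)-L$ and $h(F')-L'$ are homotopy equivalent. (2) If $D$ is diffeomorphic to the closed ball $D^{n+1}$ and $(D\times[0,1],L)\in V_n$, then $h(D)-L$ is homotopy equivalent to $(D\times[0,1])-L$.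 (3) Consequently every homotopy invariant of links in $D^{n+2}\cong D^{n+1}\times[0,1]$ extends to virtual $n$-links. Namely: (a) if $I$ assigns to every topological space an element of a set $A$, with $I(X)=I(Y)$ whenever $X$ and $Y$ are homotopy equivalent, then $[F\times[0,1],L]\mapsto I(h(F)-L)$ is a well-defined function on virtual $n$-links, and its value on $[D\times[0,1],L]$ is $I((D\times[0,1])-L)$ for every $D$ diffeomorphic to $D^{n+1}$; (b) if $D$ is diffeomorphic to $D^{n+1}$ and $\iota$ is a function, with values in a non-empty set $A$, on the links $L$ with $(D\times[0,1],L)\in V_n$ such that $\iota(L)$ depends only on the homotopy type of $(D\times[0,1])-L$, then there is a function $J$ on virtual $n$-links with $J([D\times[0,1],L])=\iota(L)$ for all such $L$, and such that $J([F\times[0,1],L])$ depends only on the homotopy type of $h(F)-L$. -/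

import Mathlib

open Set
open scoped Manifold ContDiff

universe u v

/-- The closed interval `[0,1]`, with its smooth structure as a manifold with boundary. -/
abbrev UnitI : Type := Set.Icc (0 : ℝ) 1

/-- Smooth embeddings of manifolds (possibly with boundary and corners): smooth maps with injective
differential at every point that are homeomorphisms onto their image. At boundary points this is
the classical condition on the differential; no normal form in boundary charts is required. -/
structure IsSmoothEmb
    {E : Type*} [NormedAddCommGroup E] [NormedSpace ℝ E] {H : Type*} [TopologicalSpace H]
    (I : ModelWithCorners ℝ E H)
    {E' : Type*} [NormedAddCommGroup E'] [NormedSpace ℝ E'] {H' : Type*} [TopologicalSpace H']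
    (J : ModelWithCorners ℝ E' H')
    {M : Type*} [TopologicalSpace M] [ChartedSpace H M]
    {N : Type*} [TopologicalSpace N] [ChartedSpace H' N] (f : M → N) : Prop where
  contMDiff : ContMDiff I J ∞ f
  injective_mfderiv : ∀ x, Function.Injective (mfderiv I J f x)
  isEmbedding : Topology.IsEmbedding f

/-- Compact smooth manifolds `F` of dimension `n + 1`, with possibly empty boundary. -/
structure CompactBase (n : ℕ) where
  carrier : Type u
  [top : TopologicalSpace carrier]
  [charted : ChartedSpace (EuclideanHalfSpace (n + 1)) carrier]
  [manifold : IsManifold (𝓡∂ (n + 1)) ∞ carrier]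
  [hausdorff : T2Space carrier]
  [compact : CompactSpace carrier]

namespace CompactBase

variable {n : ℕ}

instance : CoeSort (CompactBase.{u} n) (Type u) := ⟨CompactBase.carrier⟩

attribute [instance] top charted manifold hausdorff compact

/-- The thickening `F × [0,1]`, a manifold with corners. -/
abbrev Thick (F : CompactBase.{u} n) : Type u := F × UnitI

/-- The model of `F × [0,1]`. -/
noncomputable abbrev thickModel (n : ℕ) :
    ModelWithCorners ℝ (EuclideanSpace ℝ (Fin (n + 1)) × EuclideanSpace ℝ (Fin 1))
      (ModelProd (EuclideanHalfSpace (n + 1)) (EuclideanHalfSpace 1)) :=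
  (𝓡∂ (n + 1)).prod (𝓡∂ 1)

/-- The interior of `F × [0,1]` as a manifold (with corners). -/
def thickInterior (F : CompactBase.{u} n) : Set F.Thick :=
  (thickModel n).interior F.Thick

/-- A smooth embedding of an `n`-manifold `N` whose image lies in the interior of `F × [0,1]`. -/
structure IsLinkEmbedding (F : CompactBase.{u} n) {N : Type u} [TopologicalSpace N]
    [ChartedSpace (EuclideanSpace ℝ (Fin n)) N] (i : N → F.Thick) : Prop where
  smoothEmb : IsSmoothEmb (𝓡 n) (thickModel n) i
  range_subset : range i ⊆ F.thickInterior

/-- `L` is a closed (compact, without boundary) `n`-dimensional submanifold of the interior of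
`F × [0,1]`. -/
def IsLink (F : CompactBase.{u} n) (L : Set F.Thick) : Prop :=
  ∃ (N : Type u) (_ : TopologicalSpace N) (_ : ChartedSpace (EuclideanSpace ℝ (Fin n)) N)
    (_ : IsManifold (𝓡 n) ∞ N) (_ : CompactSpace N) (i : N → F.Thick),
    F.IsLinkEmbedding i ∧ range i = L

/-- `F` is diffeomorphic to the closed unit ball `D^{n+1}` of `ℝ^{n+1}`. -/
def IsDisc (F : CompactBase.{u} n) : Prop :=
  ∃ e : F → EuclideanSpace ℝ (Fin (n + 1)),
    IsSmoothEmb (𝓡∂ (n + 1)) (𝓡 (n + 1)) e ∧ range e = Metric.closedBall 0 1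

end CompactBase

/-- Links `L ⊆ F × [0,1]` such that `(F × [0,1], L)` is a pair in `V_n`. -/
structure ThickLink {n : ℕ} (F : CompactBase.{u} n) where
  carrier : Set F.Thick
  isLink : F.IsLink carrier
  meets : ∀ p : F.Thick, (connectedComponent p ∩ carrier).Nonempty

/-- The pairs `(F × [0,1], L)` making up `V_n`. -/
structure LinkPair (n : ℕ) where
  base : CompactBase.{u} n
  link : ThickLink base

/-- Smooth isotopy of links in `F × [0,1]`: a smooth one-parameter family of embeddings into the
interior, from a parametrization of `L` to a parametrization of `L'`. -/
def ThickLink.Isotopic {n : ℕ} {F : CompactBase.{u} n} (L L' : ThickLink F) : Prop :=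
  ∃ (N : Type u) (_ : TopologicalSpace N) (_ : ChartedSpace (EuclideanSpace ℝ (Fin n)) N)
    (_ : IsManifold (𝓡 n) ∞ N) (_ : CompactSpace N) (Φ : N × UnitI → F.Thick),
    ContMDiff ((𝓡 n).prod (𝓡∂ 1)) (CompactBase.thickModel n) ∞ Φ ∧
    (∀ t : UnitI, F.IsLinkEmbedding (fun x => Φ (x, t))) ∧
    range (fun x => Φ (x, 0)) = L.carrier ∧
    range (fun x => Φ (x, 1)) = L'.carrier

namespace LinkPair

variable {n : ℕ}

/-- The relation `(F₁ × [0,1], L₁) ∼ (F₂ × [0,1], L₂)`: some smooth embedding `f : F₁ → F₂`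
satisfies `(f × id)(L₁) = L₂`. -/
def EmbedsOnto (P Q : LinkPair.{u} n) : Prop :=
  ∃ f : P.base → Q.base, IsSmoothEmb (𝓡∂ (n + 1)) (𝓡∂ (n + 1)) f ∧
    Prod.map f id '' P.link.carrier = Q.link.carrier

/-- The elementary moves: the relation `∼`, and smooth isotopy of the link in a fixed
`F × [0,1]`. -/
inductive Move : LinkPair.{u} n → LinkPair.{u} n → Prop
  | embed (P Q : LinkPair.{u} n) (h : P.EmbedsOnto Q) : Move P Q
  | isotopy (F : CompactBase.{u} n) (L L' : ThickLink F) (h : L.Isotopic L') :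
      Move ⟨F, L⟩ ⟨F, L'⟩

/-- Virtual equivalence: the equivalence relation on `V_n` generated by the elementary moves. -/
def virtualSetoid (n : ℕ) : Setoid (LinkPair.{u} n) := Relation.EqvGen.setoid Move

/-- Virtual equivalence of two pairs. -/
def VirtuallyEquivalent (P Q : LinkPair.{u} n) : Prop := (virtualSetoid n).r P Q

end LinkPair

/-- Virtual `n`-links: the elements of `V_n` modulo virtual equivalence. -/
def VirtualLink (n : ℕ) : Type (u + 1) := Quotient (LinkPair.virtualSetoid.{u} n)

/-- The virtual link `[F × [0,1], L]`. -/
def LinkPair.toVirtual {n : ℕ} (P : LinkPair.{u} n) : VirtualLink.{u} n :=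
  Quotient.mk (LinkPair.virtualSetoid n) P

/-- The relation on `X × [0,1]` identifying all points of `X × {1}` with one another. -/
def coneSetoid (X : Type u) : Setoid (X × UnitI) where
  r p q := p = q ∨ (p.2 = 1 ∧ q.2 = 1)
  iseqv :=
    { refl := fun _ => Or.inl rfl
      symm := by
        rintro p q (h | h)
        · exact Or.inl h.symm
        · exact Or.inr ⟨h.2, h.1⟩
      trans := by
        rintro p q r (rfl | h) (rfl | h')
        · exact Or.inl rfl
        · exact Or.inr h'
        · exact Or.inr h
        · exact Or.inr ⟨h.1, h'.2⟩ }

/-- The space `h(X)`: `X × [0,1]` with `X × {1}` collapsed to a point, with the quotient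
topology. -/
abbrev ConeGlue (X : Type u) [TopologicalSpace X] : Type u := Quotient (coneSetoid X)

/-- The space `h(F) - L`. -/
abbrev LinkPair.ConeComplement {n : ℕ} (P : LinkPair.{u} n) : Type u :=
  {z : ConeGlue P.base // z ∉ Quotient.mk (coneSetoid P.base) '' P.link.carrier}

/-- The space `(F × [0,1]) - L`. -/
abbrev ThickLink.Complement {n : ℕ} {F : CompactBase.{u} n} (L : ThickLink F) : Type u :=
  {p : F.Thick // p ∉ L.carrier}

/-- The topological spaces `X` and `Y` have the same homotopy type. -/
def SameHomotopyType (X Y : Type u) [TopologicalSpace X] [TopologicalSpace Y] : Prop :=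
  Nonempty (ContinuousMap.HomotopyEquiv X Y)

/-! ### Lipschitz estimates and homeomorphisms of the model space -/

section LocalEstimates

open Filter Topology

/-! Since virtual equivalence is generated by two moves, it suffices to see that each preserves the
homotopy type of `h(F) - L`.

For an embedding `f : F₁ → F₂`, the inverse function theorem puts the shadow of `L₂` on `F₂` in the
interior of `f(F₁)`. The part of `F₂ × [0,1]` away from that shadow can be pushed up into the cone
point without crossing the link. A cutoff function that vanishes on the shadow and is `1` near the
complement of the interior of `f(F₁)` turns this push into a homotopy inverse `h(F₂) → h(F₁)` of the
map induced by `f`, respecting complements. This is `ConeGlue.sameHomotopyType_of_isEmbedding`.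

For an isotopy, one needs a homeomorphism of `F × [0,1]` that fixes the top and carries one link to
the other; smoothness of it is irrelevant. Instead of integrating a vector field, the motion over a
short time is broken into finitely many motions, each inside one chart. There the displacement has
small Lipschitz constant, so it extends to a perturbation of the identity that is a homeomorphism.
Connectedness of the time line then joins any two times (`exists_homeomorph_of_isotopy`).

Over a disc, the contraction of the base, switched on only at heights above those of the link or in
gaps between them and fully on at the top, undoes the coning. This is part (2); part (3) is then
formal. -/

/-- Two one-parameter families that agree at time `0`, the first an immersion there: near time `0`
the difference varies slowly compared with the first family. -/
theorem HasStrictFDerivAt.eventually_norm_displacement_le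
    {E E' : Type*} [NormedAddCommGroup E] [NormedSpace ℝ E] [FiniteDimensional ℝ E]
    [NormedAddCommGroup E'] [NormedSpace ℝ E']
    {Γ Γ' : E × ℝ → E'} {A A' : E × ℝ →L[ℝ] E'} {u₀ : E}
    (hΓ : HasStrictFDerivAt Γ A (u₀, 0)) (hΓ' : HasStrictFDerivAt Γ' A' (u₀, 0))
    (hA : Function.Injective fun w : E => A (w, 0))
    (h0 : ∀ᶠ u in 𝓝 u₀, Γ' (u, 0) = Γ (u, 0)) {ε : ℝ} (hε : 0 < ε) :
    ∀ᶠ q : ℝ × (E × E) in 𝓝 (0, (u₀, u₀)),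
      ‖(Γ' (q.2.1, q.1) - Γ (q.2.1, q.1)) - (Γ' (q.2.2, q.1) - Γ (q.2.2, q.1))‖ ≤
        ε * ‖Γ (q.2.1, q.1) - Γ (q.2.2, q.1)‖ := by
  obtain ⟨K, hK, hanti⟩ := LinearMap.exists_antilipschitzWith
    (A.comp (ContinuousLinearMap.inl ℝ E ℝ)).toLinearMap (LinearMap.ker_eq_bot.2 hA)
  have hKR : (0 : ℝ) < K := hK
  have hlow : ∀ w : E, ‖w‖ ≤ K * ‖A (w, 0)‖ := fun w => by
    simpa [dist_eq_norm, ← map_sub] using hanti.le_mul_dist w 0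
  -- The difference of the families vanishes near `u₀` at time `0`, so its derivative kills spatial
  -- directions.
  have hzero : ∀ w : E, (A' - A) (w, 0) = 0 := by
    have hinl : HasFDerivAt (fun u : E => (u, (0 : ℝ))) (ContinuousLinearMap.inl ℝ E ℝ) u₀ :=
      hasFDerivAt_prodMk_left u₀ 0
    have h1 : HasFDerivAt (fun u : E => Γ' (u, 0) - Γ (u, 0))
        ((A' - A).comp (ContinuousLinearMap.inl ℝ E ℝ)) u₀ :=
      (hΓ'.hasFDerivAt.sub hΓ.hasFDerivAt).comp (f := fun u : E => (u, (0 : ℝ))) u₀ hinl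
    have h2 : HasFDerivAt (fun u : E => Γ' (u, 0) - Γ (u, 0)) (0 : E →L[ℝ] E') u₀ :=
      (hasFDerivAt_const (0 : E') u₀).congr_of_eventuallyEq
        (h0.mono fun u hu => by simp [hu])
    intro w
    have := congrArg (fun T : E →L[ℝ] E' => T w) (h1.unique h2)
    simpa using this
  have htend : Tendsto (fun q : ℝ × (E × E) => (((q.2.1, q.1), (q.2.2, q.1)) :
      (E × ℝ) × (E × ℝ))) (𝓝 (0, (u₀, u₀))) (𝓝 ((u₀, 0), (u₀, 0))) :=
    Continuous.tendsto' (by fun_prop) _ _ rfl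
  -- The error `1 / (2 * K)` uses up half of the lower bound for `A`, leaving `‖x - y‖ ≤ 2 * K * ‖Γ
  -- (x, s) - Γ (y, s)‖`; the second constant compensates for this factor `2 * K`.
  have e1 := htend.eventually (hΓ.isLittleO.def (c := 1 / (2 * K)) (by positivity))
  have e2 := htend.eventually ((hΓ'.sub hΓ).isLittleO.def (c := ε / (2 * K)) (by positivity))
  filter_upwards [e1, e2] with q h1 h2
  obtain ⟨s, x, y⟩ := q
  have hsub : ((x, s) : E × ℝ) - (y, s) = (x - y, 0) := by simp
  simp only [hsub, hzero, sub_zero, Pi.sub_apply] at h1 h2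
  have hn : ‖((x - y, 0) : E × ℝ)‖ = ‖x - y‖ := by simp [Prod.norm_def]
  rw [hn] at h1 h2
  have h3 := hlow (x - y)
  have h4 : ‖A (x - y, 0)‖ ≤ ‖Γ (x, s) - Γ (y, s)‖ + 1 / (2 * K) * ‖x - y‖ := by
    have := norm_sub_norm_le (A (x - y, 0)) (Γ (x, s) - Γ (y, s))
    rw [norm_sub_rev (A (x - y, 0))] at this
    linarith
  have h5 : ‖x - y‖ ≤ 2 * K * ‖Γ (x, s) - Γ (y, s)‖ := by
    have h6 := mul_le_mul_of_nonneg_left h4 hKR.le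
    have h7 : (K : ℝ) * (1 / (2 * K) * ‖x - y‖) = ‖x - y‖ / 2 := by field_simp
    rw [mul_add, h7] at h6
    linarith
  calc _ ≤ ε / (2 * K) * ‖x - y‖ := h2
    _ ≤ ε / (2 * K) * (2 * K * ‖Γ (x, s) - Γ (y, s)‖) := by gcongr
    _ = _ := by field_simp

/-- A displacement of a subset of a finite-dimensional space with small Lipschitz constant is
realized by a homeomorphism of the whole space. -/
theorem exists_pos_forall_exists_homeomorph_add
    (E : Type*) [NormedAddCommGroup E] [NormedSpace ℝ E] [FiniteDimensional ℝ E] :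
    ∃ ε : ℝ, 0 < ε ∧ ∀ {ι : Type*} (α v : ι → E),
      (∀ i j, ‖v i - v j‖ ≤ ε * ‖α i - α j‖) → ∃ h : E ≃ₜ E, ∀ i, h (α i) = α i + v i := by
  set C := lipschitzExtensionConstant E with hC
  have hCpos : 0 < C := lipschitzExtensionConstant_pos E
  have hle : ‖((ContinuousLinearEquiv.refl ℝ E).symm : E →L[ℝ] E)‖₊ ≤ 1 :=
    ContinuousLinearMap.norm_id_le
  -- Lipschitz extension to all of `E` costs a factor `C`, so the extended displacement `g` has
  -- constant `1/2`, and `x ↦ x + g x` is a homeomorphism.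
  refine ⟨((2 * C)⁻¹ : NNReal), by positivity, fun {ι} α v hv => ?_⟩
  have hfac : ∀ i j, α i = α j → v i = v j := fun i j hij => by
    have := hv i j
    rw [hij, sub_self, norm_zero, mul_zero] at this
    exact sub_eq_zero.1 (norm_le_zero_iff.1 this)
  let d : E → E := Function.extend α v 0
  have hd : ∀ i, d (α i) = v i := fun i =>
    Function.FactorsThrough.extend_apply (fun i j h => hfac i j h) 0 i
  have hlip : LipschitzOnWith (2 * C)⁻¹ d (range α) := by
    refine LipschitzOnWith.of_dist_le_mul ?_
    rintro _ ⟨i, rfl⟩ _ ⟨j, rfl⟩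
    rw [hd, hd, dist_eq_norm, dist_eq_norm]
    exact hv i j
  obtain ⟨g, hg, hdg⟩ := hlip.extend_finite_dimension
  have hc : C * (2 * C)⁻¹ = (2⁻¹ : NNReal) := by
    rw [mul_inv, mul_comm, mul_assoc, inv_mul_cancel₀ hCpos.ne', mul_one]
  rw [← hC, hc] at hg
  have happ : ApproximatesLinearOn (fun x => x + g x)
      ((ContinuousLinearEquiv.refl ℝ E : E ≃L[ℝ] E) : E →L[ℝ] E) univ 2⁻¹ := by
    intro x _ y _
    have : x + g x - (y + g y) - (x - y) = g x - g y := by abel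
    simpa [this] using hg.norm_sub_le x y
  have hcond : Subsingleton E ∨
      (2⁻¹ : NNReal) < ‖((ContinuousLinearEquiv.refl ℝ E).symm : E →L[ℝ] E)‖₊⁻¹ := by
    rcases subsingleton_or_nontrivial E with h | h
    · exact Or.inl h
    · right
      have : ‖((ContinuousLinearEquiv.refl ℝ E).symm : E →L[ℝ] E)‖₊ = 1 :=
        ContinuousLinearMap.nnnorm_id
      rw [this, inv_one]
      exact inv_lt_one_of_one_lt₀ one_lt_two
  refine ⟨ApproximatesLinearOn.toHomeomorph _ happ hcond, fun i => ?_⟩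
  change α i + g (α i) = _
  rw [← hdg ⟨i, rfl⟩, hd]

/-- Transplant, by a chart, a homeomorphism of the model space supported in a compact subset of
the target of the chart. -/
theorem OpenPartialHomeomorph.exists_homeomorph_of_support_subset
    {M E : Type*} [TopologicalSpace M] [T2Space M] [TopologicalSpace E]
    (e : OpenPartialHomeomorph M E) {B : Set E} (hBc : IsCompact B) (hB : B ⊆ e.target)
    (h : E ≃ₜ E) (hh : ∀ v ∉ B, h v = v) :
    ∃ H : M ≃ₜ M, (∀ x ∈ e.source, H x = e.symm (h (e x))) ∧
      ∀ x ∉ e.symm '' B, H x = x := by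
  classical
  -- A point whose image lies outside `B` has a fixed image, hence by injectivity is itself fixed.
  have hmaps : ∀ k : E ≃ₜ E, (∀ v ∉ B, k v = v) → ∀ v ∈ e.target, k v ∈ e.target := by
    intro k hk v hv
    by_cases hvB : k v ∈ B
    · exact hB hvB
    · rw [k.injective (hk _ hvB)]
      exact hv
  have hclosed : IsClosed (e.symm '' B) :=
    (hBc.image_of_continuousOn (e.continuousOn_symm.mono hB)).isClosed
  let T : (E ≃ₜ E) → M → M := fun k x => if x ∈ e.source then e.symm (k (e x)) else x
  have hTs : ∀ k x, x ∈ e.source → T k x = e.symm (k (e x)) := fun k x hx => if_pos hx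
  have hToff : ∀ k : E ≃ₜ E, (∀ v ∉ B, k v = v) → ∀ x ∉ e.symm '' B, T k x = x := by
    intro k hk x hx
    by_cases hxs : x ∈ e.source
    · rw [hTs k x hxs, hk, e.left_inv hxs]
      exact fun hxB => hx ⟨e x, hxB, e.left_inv hxs⟩
    · exact if_neg hxs
  have hTc : ∀ k : E ≃ₜ E, (∀ v ∉ B, k v = v) → Continuous (T k) := by
    intro k hk
    rw [continuous_iff_continuousAt]
    intro x
    by_cases hxs : x ∈ e.source
    · have h1 : ContinuousAt (fun y => e.symm (k (e y))) x :=
        (e.continuousAt_symm (hmaps k hk _ (e.map_source hxs))).comp (f := fun y => k (e y))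
          (k.continuous.continuousAt.comp (f := e) (e.continuousAt hxs))
      refine h1.congr ?_
      filter_upwards [e.open_source.mem_nhds hxs] with y hy using (hTs k y hy).symm
    · have hx' : x ∉ e.symm '' B := by
        rintro ⟨b, hb, rfl⟩
        exact hxs (e.map_target (hB hb))
      refine continuousAt_id.congr ?_
      filter_upwards [hclosed.isOpen_compl.mem_nhds hx'] with y hy using (hToff k hk y hy).symm
  have hinv : ∀ k : E ≃ₜ E, (∀ v ∉ B, k v = v) → ∀ x, T k.symm (T k x) = x := by
    intro k hk x
    by_cases hxs : x ∈ e.source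
    · have hm := hmaps k hk _ (e.map_source hxs)
      rw [hTs k x hxs, hTs _ _ (e.map_target hm), e.right_inv hm, k.symm_apply_apply,
        e.left_inv hxs]
    · have hx1 : ∀ k, T k x = x := fun k => if_neg hxs
      rw [hx1 k, hx1]
  have hh' : ∀ v ∉ B, h.symm v = v := fun v hv => by
    rw [Homeomorph.symm_apply_eq, hh v hv]
  exact ⟨{ toFun := T h
           invFun := T h.symm
           left_inv := hinv h hh
           right_inv := hinv h.symm hh'
           continuous_toFun := hTc h hh
           continuous_invFun := hTc h.symm hh' }, hTs h, hToff h hh⟩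

end LocalEstimates

/-! ### Isotopies followed by ambient homeomorphisms -/

section AmbientHomeomorphisms

open Filter Topology

variable {E : Type*} [NormedAddCommGroup E] [NormedSpace ℝ E]
  {H : Type*} [TopologicalSpace H] {I : ModelWithCorners ℝ E H}
  {E' : Type*} [NormedAddCommGroup E'] [NormedSpace ℝ E']
  {H' : Type*} [TopologicalSpace H'] {J : ModelWithCorners ℝ E' H'}
  {N : Type*} [TopologicalSpace N] [ChartedSpace H N]
  {M : Type*} [TopologicalSpace M] [ChartedSpace H' M]

/-- The restriction of a preferred chart at an interior point to the preimage of a ball. -/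
theorem ModelWithCorners.IsInteriorPoint.exists_openPartialHomeomorph {p : M}
    (hp : J.IsInteriorPoint p) {U : Set M} (hU : U ∈ 𝓝 p) :
    ∃ (e : OpenPartialHomeomorph M E') (R : ℝ), 0 < R ∧ (∀ x, e x = extChartAt J p x) ∧
      p ∈ e.source ∧ e.source ⊆ (chartAt H' p).source ∩ U ∧
      Metric.closedBall (e p) (2 * R) ⊆ e.target := by
  have h1 : (extChartAt J p).target ∈ 𝓝 (extChartAt J p p) := by
    have := extChartAt_target_mem_nhdsWithin (I := J) p
    rwa [nhdsWithin_eq_nhds.2 (range_mem_nhds_isInteriorPoint hp)] at this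
  have h2 : (extChartAt J p).symm ⁻¹' U ∈ 𝓝 (extChartAt J p p) :=
    (continuousAt_extChartAt_symm p).preimage_mem_nhds (by rwa [extChartAt_to_inv])
  obtain ⟨r, hr, hball⟩ := Metric.mem_nhds_iff.1 (inter_mem h1 h2)
  let e : OpenPartialHomeomorph M E' :=
    { toFun := extChartAt J p
      invFun := (extChartAt J p).symm
      source := (extChartAt J p).source ∩ extChartAt J p ⁻¹' Metric.ball (extChartAt J p p) r
      target := Metric.ball (extChartAt J p p) r
      map_source' := fun x hx => hx.2
      map_target' := fun v hv => ⟨(extChartAt J p).map_target (hball hv).1, by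
        rw [mem_preimage, (extChartAt J p).right_inv (hball hv).1]; exact hv⟩
      left_inv' := fun x hx => (extChartAt J p).left_inv hx.1
      right_inv' := fun v hv => (extChartAt J p).right_inv (hball hv).1
      open_source := (continuousOn_extChartAt p).isOpen_inter_preimage
        (isOpen_extChartAt_source p) Metric.isOpen_ball
      open_target := Metric.isOpen_ball
      continuousOn_toFun := (continuousOn_extChartAt p).mono inter_subset_left
      continuousOn_invFun := (continuousOn_extChartAt_symm p).mono fun v hv => (hball hv).1 }
  refine ⟨e, r / 4, by positivity, fun _ => rfl,
    ⟨mem_extChartAt_source p, Metric.mem_ball_self hr⟩, fun x hx => ⟨?_, ?_⟩,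
    Metric.closedBall_subset_ball (by linarith)⟩
  · rw [← extChartAt_source J]; exact hx.1
  · have := (hball hx.2).2
    rwa [mem_preimage, (extChartAt J p).left_inv hx.1] at this

variable [I.Boundaryless] [IsManifold I ∞ N] [IsManifold J ∞ M]

/-- The expression in charts of a one-parameter family of maps is continuously differentiable. -/
theorem contDiffAt_family_extChartAt {G : N × ℝ → M}
    (hG : ContMDiff (I.prod 𝓘(ℝ, ℝ)) J ∞ G) {p : M} {x : N} {s : ℝ}
    (hx : G (x, s) ∈ (chartAt H' p).source) :
    ContDiffAt ℝ ∞ (fun q : E × ℝ => extChartAt J p (G ((extChartAt I x).symm q.1, q.2)))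
      (extChartAt I x x, s) := by
  have hsymm : ContMDiffAt 𝓘(ℝ, E) I ∞ (extChartAt I x).symm (extChartAt I x x) :=
    (contMDiffOn_extChartAt_symm x).contMDiffAt (extChartAt_target_mem_nhds x)
  have h1 : ContMDiffAt (𝓘(ℝ, E).prod 𝓘(ℝ, ℝ)) (I.prod 𝓘(ℝ, ℝ)) ∞
      (fun q : E × ℝ => ((extChartAt I x).symm q.1, q.2)) (extChartAt I x x, s) :=
    (hsymm.comp (extChartAt I x x, s) contMDiffAt_fst).prodMk contMDiffAt_snd
  have hx' : G ((extChartAt I x).symm (extChartAt I x x), s) = G (x, s) := by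
    rw [extChartAt_to_inv]
  have h2 : ContMDiffAt (𝓘(ℝ, E).prod 𝓘(ℝ, ℝ)) J ∞
      (fun q : E × ℝ => G ((extChartAt I x).symm q.1, q.2)) (extChartAt I x x, s) :=
    hG.contMDiffAt.comp (extChartAt I x x, s) h1
  have h3 : ContMDiffAt (𝓘(ℝ, E).prod 𝓘(ℝ, ℝ)) 𝓘(ℝ, E') ∞
      (fun q : E × ℝ => extChartAt J p (G ((extChartAt I x).symm q.1, q.2)))
      (extChartAt I x x, s) :=
    (contMDiffAt_extChartAt' (I := J) (n := ∞) (x := p) (by rw [hx']; exact hx)).comp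
      (extChartAt I x x, s) h2
  rw [← modelWithCornersSelf_prod, chartedSpaceSelf_prod] at h3
  exact h3.contDiffAt

/-- By the chain rule, the spatial derivative in charts is the manifold derivative composed with the
invertible derivatives of two charts. -/
theorem injective_fderiv_family_extChartAt {G : N × ℝ → M}
    (hG : ContMDiff (I.prod 𝓘(ℝ, ℝ)) J ∞ G) {p : M} {x : N} {s : ℝ}
    (hx : G (x, s) ∈ (chartAt H' p).source)
    (hinj : Function.Injective (mfderiv I J (fun y => G (y, s)) x)) :
    Function.Injective fun w : E =>
      fderiv ℝ (fun q : E × ℝ => extChartAt J p (G ((extChartAt I x).symm q.1, q.2)))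
        (extChartAt I x x, s) (w, 0) := by
  set u₀ := extChartAt I x x with hu₀
  have hxu : (extChartAt I x).symm u₀ = x := extChartAt_to_inv x
  have hsymm : MDifferentiableAt 𝓘(ℝ, E) I (extChartAt I x).symm u₀ :=
    ((contMDiffOn_extChartAt_symm (n := ∞) x).contMDiffAt
      (extChartAt_target_mem_nhds x)).mdifferentiableAt (by simp)
  have hinl : HasFDerivAt (fun u : E => (u, s)) (ContinuousLinearMap.inl ℝ E ℝ) u₀ :=
    hasFDerivAt_prodMk_left u₀ s
  have hΓ := (contDiffAt_family_extChartAt hG hx).differentiableAt (by simp)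
  have h1 := hΓ.hasFDerivAt.comp (f := fun u : E => (u, s)) u₀ hinl
  have hGs : MDifferentiableAt I J (fun y => G (y, s)) ((extChartAt I x).symm u₀) :=
    (hG.comp (contMDiff_id.prodMk contMDiff_const)).mdifferentiableAt (by simp)
  have hφ : MDifferentiableAt J 𝓘(ℝ, E') (extChartAt J p) (G ((extChartAt I x).symm u₀, s)) :=
    (contMDiffAt_extChartAt' (I := J) (n := ∞) (x := p)
      (by rw [hxu]; exact hx)).mdifferentiableAt (by simp)
  have h2 := (hφ.hasMFDerivAt.comp u₀
    ((hGs.hasMFDerivAt.comp u₀ hsymm.hasMFDerivAt))).hasFDerivAt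
  have h3 := h1.unique h2
  have hsinj : Function.Injective (mfderiv 𝓘(ℝ, E) I (extChartAt I x).symm u₀) := by
    have := isInvertible_mfderivWithin_extChartAt_symm (I := I) (mem_extChartAt_target x)
    rw [I.range_eq_univ, mfderivWithin_univ] at this
    exact this.injective
  have hφinj := (isInvertible_mfderiv_extChartAt (I := J) (x := p)
    (y := G ((extChartAt I x).symm u₀, s)) (by rw [hxu, extChartAt_source]; exact hx)).injective
  have hGinj : Function.Injective
      (mfderiv I J (fun y => G (y, s)) ((extChartAt I x).symm u₀)) := by
    rw [hxu]; exact hinj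
  have h4 := hφinj.comp (hGinj.comp hsinj)
  intro w w' hww
  apply h4
  have h5 := congrArg (fun T : E →L[ℝ] E' => T w) h3
  have h6 := congrArg (fun T : E →L[ℝ] E' => T w') h3
  exact h5.symm.trans (Eq.trans hww h6)

variable [FiniteDimensional ℝ E]

/-- Compactness of `N × N` reduces this to a neighbourhood of each pair `(x, y)`. On the diagonal
the immersion estimate applies; off it, at time `0` the left side is zero and the right side is
positive by injectivity. Pairs not both in `K` at time `0` stay so nearby, because `K` is closed. -/
theorem eventually_forall_norm_displacement_le [CompactSpace N] {G G' : N × ℝ → M}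
    (hG : ContMDiff (I.prod 𝓘(ℝ, ℝ)) J ∞ G) (hG' : ContMDiff (I.prod 𝓘(ℝ, ℝ)) J ∞ G')
    (h0 : ∀ x, G' (x, 0) = G (x, 0)) (hinj : Function.Injective fun x => G (x, 0))
    (hderiv : ∀ x, Function.Injective (mfderiv I J (fun y => G (y, 0)) x))
    {p : M} {K : Set M} (hKc : IsClosed K) (hK : K ⊆ (chartAt H' p).source)
    {ε : ℝ} (hε : 0 < ε) :
    ∀ᶠ s in 𝓝 (0 : ℝ), ∀ x y, G (x, s) ∈ K → G (y, s) ∈ K →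
      ‖(extChartAt J p (G' (x, s)) - extChartAt J p (G (x, s))) -
          (extChartAt J p (G' (y, s)) - extChartAt J p (G (y, s)))‖ ≤
        ε * ‖extChartAt J p (G (x, s)) - extChartAt J p (G (y, s))‖ := by
  suffices h : ∀ᶠ s in 𝓝 (0 : ℝ), ∀ q ∈ (univ : Set (N × N)), G (q.1, s) ∈ K → G (q.2, s) ∈ K →
      ‖(extChartAt J p (G' (q.1, s)) - extChartAt J p (G (q.1, s))) -
          (extChartAt J p (G' (q.2, s)) - extChartAt J p (G (q.2, s)))‖ ≤
        ε * ‖extChartAt J p (G (q.1, s)) - extChartAt J p (G (q.2, s))‖ from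
    h.mono fun s hs x y => hs (x, y) (mem_univ _)
  refine isCompact_univ.eventually_forall_of_forall_eventually ?_
  rintro ⟨x, y⟩ -
  have cfst : ContinuousAt (fun z : ℝ × (N × N) => (z.2.1, z.1)) (0, (x, y)) := by fun_prop
  have csnd : ContinuousAt (fun z : ℝ × (N × N) => (z.2.2, z.1)) (0, (x, y)) := by fun_prop
  by_cases hx : G (x, 0) ∈ K
  swap
  · have : ∀ᶠ z : ℝ × (N × N) in 𝓝 (0, (x, y)), G (z.2.1, z.1) ∈ Kᶜ :=
      (hG.continuous.comp (f := fun z : ℝ × (N × N) => (z.2.1, z.1))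
        (by fun_prop)).continuousAt.eventually_mem
        (hKc.isOpen_compl.mem_nhds hx)
    exact this.mono fun z hz h => absurd h hz
  by_cases hy : G (y, 0) ∈ K
  swap
  · have : ∀ᶠ z : ℝ × (N × N) in 𝓝 (0, (x, y)), G (z.2.2, z.1) ∈ Kᶜ :=
      (hG.continuous.comp (f := fun z : ℝ × (N × N) => (z.2.2, z.1))
        (by fun_prop)).continuousAt.eventually_mem
        (hKc.isOpen_compl.mem_nhds hy)
    exact this.mono fun z hz _ h => absurd h hz
  by_cases hxy : x = y
  · subst hxy
    have hA := contDiffAt_family_extChartAt hG (hK hx)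
    have hA' := contDiffAt_family_extChartAt hG' (p := p) (x := x) (s := 0)
      (by rw [h0]; exact hK hx)
    have key := (hA.hasStrictFDerivAt (by simp)).eventually_norm_displacement_le
      (hA'.hasStrictFDerivAt (by simp))
      (injective_fderiv_family_extChartAt hG (hK hx) (hderiv x))
      (Eventually.of_forall fun u => by simp only [h0]) hε
    have hc : ContinuousAt (fun z : ℝ × (N × N) =>
        (z.1, (extChartAt I x z.2.1, extChartAt I x z.2.2))) (0, (x, x)) := by
      have h := continuousAt_extChartAt (I := I) x
      exact continuousAt_fst.prodMk
        ((ContinuousAt.comp (f := fun z : ℝ × (N × N) => z.2.1) h (by fun_prop)).prodMk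
          (ContinuousAt.comp (f := fun z : ℝ × (N × N) => z.2.2) h (by fun_prop)))
    have hsrc := (isOpen_extChartAt_source (I := I) x).mem_nhds (mem_extChartAt_source x)
    have s1 : ∀ᶠ z : ℝ × (N × N) in 𝓝 (0, (x, x)), z.2.1 ∈ (extChartAt I x).source :=
      ContinuousAt.eventually_mem (f := fun z : ℝ × (N × N) => z.2.1) (by fun_prop) hsrc
    have s2 : ∀ᶠ z : ℝ × (N × N) in 𝓝 (0, (x, x)), z.2.2 ∈ (extChartAt I x).source :=
      ContinuousAt.eventually_mem (f := fun z : ℝ × (N × N) => z.2.2) (by fun_prop) hsrc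
    filter_upwards [hc.eventually key, s1, s2] with z hz h1 h2 _ _
    simpa only [(extChartAt I x).left_inv h1, (extChartAt I x).left_inv h2] using hz
  · have e1 : ∀ {F : N × ℝ → M} (_ : ContMDiff (I.prod 𝓘(ℝ, ℝ)) J ∞ F) {w : N}
        {f : ℝ × (N × N) → N × ℝ} (_ : ContinuousAt f (0, (x, y))) (_ : f (0, (x, y)) = (w, 0))
        (_ : F (w, 0) ∈ K),
        ContinuousAt (fun z => extChartAt J p (F (f z))) (0, (x, y)) := by
      intro F hF w f hf hfw hw
      have h1 : ContinuousAt (extChartAt J p) (F (f (0, (x, y)))) :=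
        continuousAt_extChartAt' (by rw [extChartAt_source, hfw]; exact hK hw)
      exact h1.comp (f := fun z => F (f z)) (hF.continuous.continuousAt.comp hf)
    have c1 := e1 hG cfst rfl hx
    have c2 := e1 hG csnd rfl hy
    have c3 := e1 hG' cfst rfl (by rw [h0]; exact hx)
    have c4 := e1 hG' csnd rfl (by rw [h0]; exact hy)
    have hne : extChartAt J p (G (x, 0)) ≠ extChartAt J p (G (y, 0)) := fun h =>
      hxy (hinj ((extChartAt J p).injOn (by rw [extChartAt_source]; exact hK hx)
        (by rw [extChartAt_source]; exact hK hy) h))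
    have hlt : ‖(extChartAt J p (G' (x, 0)) - extChartAt J p (G (x, 0))) -
          (extChartAt J p (G' (y, 0)) - extChartAt J p (G (y, 0)))‖ <
        ε * ‖extChartAt J p (G (x, 0)) - extChartAt J p (G (y, 0))‖ := by
      rw [h0, h0, sub_self, sub_self, sub_self, norm_zero]
      exact mul_pos hε (norm_pos_iff.2 (sub_ne_zero.2 hne))
    have := ContinuousAt.eventually_lt ((c3.sub c1).sub (c4.sub c2)).norm
      (continuousAt_const.mul (c1.sub c2).norm) hlt
    exact this.mono fun z hz _ _ => hz.le

variable [FiniteDimensional ℝ E']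

/-- A small motion of an embedded compact manifold that takes place in one chart is followed by
an ambient homeomorphism supported in that chart. -/
theorem eventually_exists_homeomorph_of_motion_in_chart [CompactSpace N] [T2Space M]
    {G G' : N × ℝ → M}
    (hG : ContMDiff (I.prod 𝓘(ℝ, ℝ)) J ∞ G) (hG' : ContMDiff (I.prod 𝓘(ℝ, ℝ)) J ∞ G')
    (h0 : ∀ x, G' (x, 0) = G (x, 0)) (hinj : Function.Injective fun x => G (x, 0))
    (hderiv : ∀ x, Function.Injective (mfderiv I J (fun y => G (y, 0)) x))
    {p : M} (e : OpenPartialHomeomorph M E') (he : ∀ x, e x = extChartAt J p x)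
    (hes : e.source ⊆ (chartAt H' p).source) {R : ℝ} (hR : 0 < R)
    (hball : Metric.closedBall (e p) (2 * R) ⊆ e.target)
    {C : Set N} (hC : IsClosed C)
    (hCe : ∀ x ∈ C, G (x, 0) ∈ e.source ∩ e ⁻¹' Metric.ball (e p) R)
    (hGG' : ∀ x ∉ C, ∀ s, G' (x, s) = G (x, s)) :
    ∀ᶠ s in 𝓝 (0 : ℝ), ∃ Θ : M ≃ₜ M, (∀ z ∉ e.source, Θ z = z) ∧
      ∀ x, Θ (G (x, s)) = G' (x, s) := by
  obtain ⟨ε, hε, hlip⟩ := exists_pos_forall_exists_homeomorph_add E'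
  set B := Metric.closedBall (e p) (2 * R) with hB
  have hBc : IsCompact B := isCompact_closedBall _ _
  set K := e.symm '' B with hK
  have hKs : K ⊆ e.source := by
    rintro _ ⟨b, hb, rfl⟩; exact e.map_target (hball hb)
  have hKc : IsClosed K := (hBc.image_of_continuousOn (e.continuousOn_symm.mono hball)).isClosed
  have ev1 := eventually_forall_norm_displacement_le hG hG' h0 hinj hderiv hKc (hKs.trans hes) hε
  have ev2 : ∀ᶠ s in 𝓝 (0 : ℝ), ∀ x ∈ C, G (x, s) ∈ e.source ∩ e ⁻¹' Metric.ball (e p) R ∧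
      G' (x, s) ∈ e.source ∧ ‖e (G' (x, s)) - e (G (x, s))‖ < ε * R := by
    refine hC.isCompact.eventually_forall_of_forall_eventually fun x hx => ?_
    have cG : ContinuousAt (fun z : ℝ × N => G (z.2, z.1)) (0, x) :=
      (hG.continuous.comp (f := fun z : ℝ × N => (z.2, z.1)) (by fun_prop)).continuousAt
    have cG' : ContinuousAt (fun z : ℝ × N => G' (z.2, z.1)) (0, x) :=
      (hG'.continuous.comp (f := fun z : ℝ × N => (z.2, z.1)) (by fun_prop)).continuousAt
    have hx' : G' (x, 0) ∈ e.source := by rw [h0]; exact (hCe x hx).1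
    have o := (e.continuousOn.isOpen_inter_preimage e.open_source
      (Metric.isOpen_ball (x := e p) (ε := R)))
    have c1 : ContinuousAt (fun z : ℝ × N => e (G (z.2, z.1))) (0, x) :=
      (e.continuousAt (hCe x hx).1).comp (f := fun z : ℝ × N => G (z.2, z.1)) cG
    have c2 : ContinuousAt (fun z : ℝ × N => e (G' (z.2, z.1))) (0, x) :=
      (e.continuousAt hx').comp (f := fun z : ℝ × N => G' (z.2, z.1)) cG'
    have hlt : ‖e (G' (x, 0)) - e (G (x, 0))‖ < ε * R := by
      rw [h0, sub_self, norm_zero]; positivity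
    exact (cG.eventually_mem (o.mem_nhds (hCe x hx))).and
      ((cG'.eventually_mem (e.open_source.mem_nhds hx')).and
        ((c2.sub c1).norm.eventually_lt continuousAt_const hlt))
  filter_upwards [ev1, ev2] with s h1 h2
  simp only [← he] at h1
  have hCK : ∀ x ∈ C, G (x, s) ∈ K := fun x hx =>
    ⟨e (G (x, s)), Metric.ball_subset_closedBall.trans
      (Metric.closedBall_subset_closedBall (by linarith)) (h2 x hx).1.2,
      e.left_inv (h2 x hx).1.1⟩
  -- Prescribing zero displacement at every point outside `B`, along with the motion inside, forces
  -- the resulting homeomorphism to be supported in `B`.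
  let α : {x // G (x, s) ∈ K} ⊕ {b // b ∉ B} → E' :=
    Sum.elim (fun x => e (G (x.1, s))) (fun b => b.1)
  let v : {x // G (x, s) ∈ K} ⊕ {b // b ∉ B} → E' :=
    Sum.elim (fun x => e (G' (x.1, s)) - e (G (x.1, s))) (fun _ => 0)
  -- Points that move lie within `R` of the centre and points outside `B` beyond `2 * R`, so they
  -- are at least `R` apart, while the displacement is below `ε * R`.
  have hmix : ∀ x : {x // G (x, s) ∈ K}, ∀ b : {b // b ∉ B},
      ‖e (G' (x.1, s)) - e (G (x.1, s))‖ ≤ ε * ‖e (G (x.1, s)) - b.1‖ := by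
    rintro ⟨x, hx⟩ ⟨b, hb⟩
    by_cases hxC : x ∈ C
    · have hd1 : dist (e (G (x, s))) (e p) < R := (h2 x hxC).1.2
      have hd2 : 2 * R < dist b (e p) := not_le.1 hb
      have hd3 := dist_triangle b (e (G (x, s))) (e p)
      have hd4 : R ≤ ‖e (G (x, s)) - b‖ := by
        rw [← dist_eq_norm, dist_comm]; linarith
      exact (h2 x hxC).2.2.le.trans (by gcongr)
    · simp only [hGG' x hxC, sub_self, norm_zero]
      positivity
  have hv : ∀ i j, ‖v i - v j‖ ≤ ε * ‖α i - α j‖ := by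
    rintro (x | b) (y | c)
    · exact h1 x y x.2 y.2
    · simpa [v, α] using hmix x c
    · simpa [v, α, norm_sub_rev] using hmix y b
    · simp only [v, α, Sum.elim_inr, sub_self, norm_zero]; positivity
  obtain ⟨h, hh⟩ := hlip α v hv
  obtain ⟨Θ, hΘ, hΘoff⟩ := e.exists_homeomorph_of_support_subset hBc hball h
    fun b hb => by simpa [α, v] using hh (Sum.inr ⟨b, hb⟩)
  refine ⟨Θ, fun z hz => hΘoff z fun hzK => hz (hKs hzK), fun x => ?_⟩
  by_cases hx : G (x, s) ∈ K
  · have h3 : h (e (G (x, s))) = e (G' (x, s)) := by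
      simpa [α, v] using hh (Sum.inl ⟨x, hx⟩)
    rw [hΘ _ (hKs hx), h3]
    by_cases hxC : x ∈ C
    · exact e.left_inv (h2 x hxC).2.1
    · rw [hGG' x hxC]; exact e.left_inv (hKs hx)
  · rw [hΘoff _ hx, hGG' x fun hxC => hx (hCK x hxC)]

/-- A smooth isotopy of embeddings of a compact manifold into the interior is locally followed by
ambient homeomorphisms fixing a closed set that is disjoint from the image. -/
theorem eventually_exists_homeomorph_of_isotopy [CompactSpace N] [T2Space N] [T2Space M]
    {Ψ : N × ℝ → M} (hΨ : ContMDiff (I.prod 𝓘(ℝ, ℝ)) J ∞ Ψ) {t : ℝ}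
    (hinj : Function.Injective fun x => Ψ (x, t))
    (hderiv : ∀ x, Function.Injective (mfderiv I J (fun y => Ψ (y, t)) x))
    (hint : ∀ x, J.IsInteriorPoint (Ψ (x, t)))
    {Z : Set M} (hZ : IsClosed Z) (hΨZ : ∀ x, Ψ (x, t) ∉ Z) :
    ∀ᶠ s in 𝓝 t, ∃ Θ : M ≃ₜ M, (∀ z ∈ Z, Θ z = z) ∧ ∀ x, Θ (Ψ (x, t)) = Ψ (x, s) := by
  have hfam : ∀ {σ : N → ℝ}, ContMDiff I 𝓘(ℝ, ℝ) ∞ σ →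
      ContMDiff (I.prod 𝓘(ℝ, ℝ)) J ∞ fun q : N × ℝ => Ψ (q.1, t + q.2 * σ q.1) := by
    intro σ hσ
    refine hΨ.comp (contMDiff_fst.prodMk ?_)
    exact contMDiff_const.add (contMDiff_snd.mul (hσ.comp contMDiff_fst))
  have hcongr : ∀ {f g : N → M}, f = g → ∀ y, Function.Injective (mfderiv I J f y) →
      Function.Injective (mfderiv I J g y) := by
    rintro f _ rfl y h
    exact h
  -- Fragmentation: the point `x` runs at its own speed `σ x`, and speed `0` is raised to `1` one
  -- chart at a time over a finite cover. At `s = 0` every such family is `Ψ (·, t)`, so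
  -- embeddedness is needed only at time `t`.
  have main : ∀ σ : N → ℝ, ContMDiff I 𝓘(ℝ, ℝ) ∞ σ → ∃ σ' : N → ℝ, ContMDiff I 𝓘(ℝ, ℝ) ∞ σ' ∧
      (∀ x, σ x = 1 → σ' x = 1) ∧ (∀ x ∈ (univ : Set N), σ' x = 1) ∧
      ∀ᶠ s in 𝓝 (0 : ℝ), ∃ Θ : M ≃ₜ M, (∀ z ∈ Z, Θ z = z) ∧
        ∀ x, Θ (Ψ (x, t + s * σ x)) = Ψ (x, t + s * σ' x) := by
    refine isCompact_univ.induction_on (p := fun S : Set N => ∀ σ : N → ℝ,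
      ContMDiff I 𝓘(ℝ, ℝ) ∞ σ → ∃ σ' : N → ℝ, ContMDiff I 𝓘(ℝ, ℝ) ∞ σ' ∧
      (∀ x, σ x = 1 → σ' x = 1) ∧ (∀ x ∈ S, σ' x = 1) ∧
      ∀ᶠ s in 𝓝 (0 : ℝ), ∃ Θ : M ≃ₜ M, (∀ z ∈ Z, Θ z = z) ∧
        ∀ x, Θ (Ψ (x, t + s * σ x)) = Ψ (x, t + s * σ' x)) ?_ ?_ ?_ ?_
    · exact fun σ hσ => ⟨σ, hσ, fun _ h => h, fun _ h => h.elim,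
        Eventually.of_forall fun s => ⟨Homeomorph.refl M, fun _ _ => rfl, fun _ => rfl⟩⟩
    · intro S T hST hT σ hσ
      obtain ⟨σ', h1, h2, h3, h4⟩ := hT σ hσ
      exact ⟨σ', h1, h2, fun x hx => h3 x (hST hx), h4⟩
    · intro S T hS hT σ hσ
      obtain ⟨σ', h1, h2, h3, h4⟩ := hS σ hσ
      obtain ⟨σ'', k1, k2, k3, k4⟩ := hT σ' h1
      refine ⟨σ'', k1, fun x hx => k2 x (h2 x hx), fun x hx => ?_, ?_⟩
      · exact hx.elim (fun hx => k2 x (h3 x hx)) (k3 x)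
      · filter_upwards [h4, k4] with s ⟨Θ, hΘ, hΘ'⟩ ⟨Ξ, hΞ, hΞ'⟩
        exact ⟨Θ.trans Ξ, fun z hz => by simp [hΘ z hz, hΞ z hz],
          fun x => by simp [hΘ' x, hΞ' x]⟩
    · intro x _
      obtain ⟨e, R, hR, he, hxe, hes, hball⟩ :=
        (hint x).exists_openPartialHomeomorph (hZ.isOpen_compl.mem_nhds (hΨZ x))
      set p := Ψ (x, t)
      have hcont : Continuous fun y => Ψ (y, t) := hΨ.continuous.comp (by fun_prop)
      have ho : IsOpen (e.source ∩ e ⁻¹' Metric.ball (e p) R) :=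
        e.continuousOn.isOpen_inter_preimage e.open_source Metric.isOpen_ball
      have hnhds : (fun y => Ψ (y, t)) ⁻¹' (e.source ∩ e ⁻¹' Metric.ball (e p) R) ∈ 𝓝 x :=
        (ho.preimage hcont).mem_nhds ⟨hxe, Metric.mem_ball_self hR⟩
      obtain ⟨b, -, hb⟩ := (SmoothBumpFunction.nhds_basis_tsupport (I := I) x).mem_iff.1 hnhds
      refine ⟨{y | b y = 1}, mem_nhdsWithin_of_mem_nhds b.eventuallyEq_one, fun σ hσ => ?_⟩
      -- The new speed satisfies `1 - σ' = (1 - σ) * (1 - b)`: it is `1` where `σ` or `b` is `1`,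
      -- and equals `σ` off the support of `b`.
      have hσ' : ContMDiff I 𝓘(ℝ, ℝ) ∞ fun y => σ y + (1 - σ y) * b y :=
        hσ.add ((contMDiff_const.sub hσ).mul b.contMDiff)
      refine ⟨_, hσ', fun y hy => by simp [hy], fun y hy => ?_, ?_⟩
      · have : b y = 1 := hy
        simp [this]
      · have key := eventually_exists_homeomorph_of_motion_in_chart (hfam hσ) (hfam hσ')
          (by simp) (by simpa using hinj)
          (fun y => hcongr (by simp) y (hderiv y)) e he
          (hes.trans inter_subset_left) hR hball (isClosed_tsupport b)
          (fun y hy => by simpa using hb hy)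
          (fun y hy s => by simp [image_eq_zero_of_notMem_tsupport hy])
        filter_upwards [key] with s ⟨Θ, hΘ, hΘ'⟩
        exact ⟨Θ, fun z hz => hΘ z fun hze => (hes hze).2 hz, hΘ'⟩
  obtain ⟨σ, -, -, h1, h2⟩ := main (fun _ => 0) contMDiff_const
  have htend : Tendsto (fun s : ℝ => s - t) (𝓝 t) (𝓝 0) :=
    Continuous.tendsto' (by fun_prop) _ _ (sub_self t)
  filter_upwards [htend.eventually h2] with s ⟨Θ, hΘ, hΘ'⟩
  exact ⟨Θ, hΘ, fun x => by simpa [h1 x (mem_univ x)] using hΘ' x⟩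

/-- Being joined by such a homeomorphism is an equivalence relation on times whose classes are open
by the local result, and the line is connected. -/
theorem exists_homeomorph_of_isotopy [CompactSpace N] [T2Space N] [T2Space M]
    {Ψ : N × ℝ → M} (hΨ : ContMDiff (I.prod 𝓘(ℝ, ℝ)) J ∞ Ψ)
    (hinj : ∀ t, Function.Injective fun x => Ψ (x, t))
    (hderiv : ∀ t x, Function.Injective (mfderiv I J (fun y => Ψ (y, t)) x))
    (hint : ∀ t x, J.IsInteriorPoint (Ψ (x, t)))
    {Z : Set M} (hZ : IsClosed Z) (hΨZ : ∀ t x, Ψ (x, t) ∉ Z) (s t : ℝ) :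
    ∃ Θ : M ≃ₜ M, (∀ z ∈ Z, Θ z = z) ∧ ∀ x, Θ (Ψ (x, s)) = Ψ (x, t) := by
  refine isPreconnected_univ.induction₂ (fun s t : ℝ => ∃ Θ : M ≃ₜ M, (∀ z ∈ Z, Θ z = z) ∧
    ∀ x, Θ (Ψ (x, s)) = Ψ (x, t)) ?_ ?_ ?_ (mem_univ s) (mem_univ t)
  · intro t _
    rw [nhdsWithin_univ]
    exact eventually_exists_homeomorph_of_isotopy hΨ (hinj t) (hderiv t) (hint t) hZ (hΨZ t)
  · rintro _ _ _ - - - ⟨Θ, hΘ, hΘ'⟩ ⟨Ξ, hΞ, hΞ'⟩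
    exact ⟨Θ.trans Ξ, fun z hz => by simp [hΘ z hz, hΞ z hz], fun x => by simp [hΘ' x, hΞ' x]⟩
  · rintro _ _ - - ⟨Θ, hΘ, hΘ'⟩
    exact ⟨Θ.symm, fun z hz => by rw [Homeomorph.symm_apply_eq, hΘ z hz],
      fun x => by rw [Homeomorph.symm_apply_eq, hΘ' x]⟩

end AmbientHomeomorphisms

/-! ### Inverse function theorem at interior points -/

section LocalSurjectivity

open Filter Topology

/-- At an interior point, a continuously differentiable map with injective differential between
manifolds modelled on the same finite-dimensional space covers a neighbourhood of the image
point. -/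
theorem ModelWithCorners.IsInteriorPoint.range_mem_nhds
    {E : Type*} [NormedAddCommGroup E] [NormedSpace ℝ E] [FiniteDimensional ℝ E]
    {H : Type*} [TopologicalSpace H] {I : ModelWithCorners ℝ E H}
    {H' : Type*} [TopologicalSpace H'] {J : ModelWithCorners ℝ E H'}
    {M : Type*} [TopologicalSpace M] [ChartedSpace H M]
    {N : Type*} [TopologicalSpace N] [ChartedSpace H' N]
    {f : M → N} {x : M} (hx : I.IsInteriorPoint x) (hf : ContMDiffAt I J 1 f x)
    (hinj : Function.Injective (mfderiv I J f x)) : range f ∈ 𝓝 (f x) := by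
  set u₀ := extChartAt I x x with hu₀
  set g : E → E := extChartAt J (f x) ∘ f ∘ (extChartAt I x).symm with hg
  have hxu : (extChartAt I x).symm u₀ = x := extChartAt_to_inv x
  have hrange : range I ∈ 𝓝 u₀ := range_mem_nhds_isInteriorPoint hx
  have hgd : ContDiffAt ℝ 1 g u₀ := (contMDiffAt_iff.1 hf).2.contDiffAt hrange
  have hder : mfderiv I J f x = fderiv ℝ g u₀ := by
    rw [(hf.mdifferentiableAt one_ne_zero).mfderiv]
    exact fderivWithin_of_mem_nhds hrange
  have hinj' : Function.Injective (fderiv ℝ g u₀) := by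
    rw [← hder]; exact hinj
  -- Both manifolds have the same finite-dimensional model, so an injective derivative is
  -- invertible.
  let A : E ≃L[ℝ] E :=
    (LinearEquiv.ofInjectiveEndo (fderiv ℝ g u₀).toLinearMap hinj').toContinuousLinearEquiv
  have hA : (A : E →L[ℝ] E) = fderiv ℝ g u₀ := by ext v; rfl
  have hstrict : HasStrictFDerivAt g (A : E →L[ℝ] E) u₀ := by
    rw [hA]; exact hgd.hasStrictFDerivAt one_ne_zero
  have hgu : g u₀ = extChartAt J (f x) (f x) := by
    rw [hg, Function.comp_apply, Function.comp_apply, hxu]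
  have hdom : {u | f ((extChartAt I x).symm u) ∈ (extChartAt J (f x)).source} ∈ 𝓝 u₀ := by
    have hc : ContinuousAt (f ∘ (extChartAt I x).symm) u₀ :=
      ContinuousAt.comp (by rw [hxu]; exact hf.continuousAt) (continuousAt_extChartAt_symm x)
    refine hc.preimage_mem_nhds ?_
    rw [Function.comp_apply, hxu]
    exact extChartAt_source_mem_nhds (f x)
  have himage : g '' {u | f ((extChartAt I x).symm u) ∈ (extChartAt J (f x)).source} ∈
      𝓝 (extChartAt J (f x) (f x)) := by
    rw [← hgu, ← hstrict.map_nhds_eq_of_equiv]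
    exact image_mem_map hdom
  filter_upwards [(continuousAt_extChartAt (I := J) (f x)).preimage_mem_nhds himage,
    extChartAt_source_mem_nhds (I := J) (f x)] with y hy hys
  obtain ⟨u, hu, huy⟩ := hy
  exact ⟨_, (extChartAt J (f x)).injOn hu hys huy⟩

end LocalSurjectivity

/-! ### Homotopy equivalence of complements -/

section HomotopyTypes

theorem SameHomotopyType.refl (X : Type u) [TopologicalSpace X] : SameHomotopyType X X :=
  ⟨ContinuousMap.HomotopyEquiv.refl X⟩

theorem SameHomotopyType.symm {X Y : Type u} [TopologicalSpace X] [TopologicalSpace Y]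
    (h : SameHomotopyType X Y) : SameHomotopyType Y X :=
  h.map ContinuousMap.HomotopyEquiv.symm

theorem SameHomotopyType.trans {X Y Z : Type u} [TopologicalSpace X] [TopologicalSpace Y]
    [TopologicalSpace Z] (h : SameHomotopyType X Y) (h' : SameHomotopyType Y Z) :
    SameHomotopyType X Z :=
  h.elim fun e => h'.map e.trans

/-- Homotopy inverse maps of pairs, with homotopies through maps that respect complements, induce
a homotopy equivalence of complements. -/
theorem sameHomotopyType_compl {X Y : Type u} [TopologicalSpace X] [TopologicalSpace Y]
    {A : Set X} {B : Set Y} (f : C(X, Y)) (g : C(Y, X))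
    (F : C(unitInterval × X, X)) (G : C(unitInterval × Y, Y))
    (hf : ∀ x ∉ A, f x ∉ B) (hg : ∀ y ∉ B, g y ∉ A)
    (hF : ∀ s, ∀ x ∉ A, F (s, x) ∉ A) (hG : ∀ s, ∀ y ∉ B, G (s, y) ∉ B)
    (hF0 : ∀ x, F (0, x) = x) (hF1 : ∀ x, F (1, x) = g (f x))
    (hG0 : ∀ y, G (0, y) = y) (hG1 : ∀ y, G (1, y) = f (g y)) :
    SameHomotopyType {x // x ∉ A} {y // y ∉ B} := by
  let f' : C({x // x ∉ A}, {y // y ∉ B}) :=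
    ⟨fun x => ⟨f x, hf x x.2⟩, by fun_prop⟩
  let g' : C({y // y ∉ B}, {x // x ∉ A}) :=
    ⟨fun y => ⟨g y, hg y y.2⟩, by fun_prop⟩
  let F' : ContinuousMap.Homotopy (ContinuousMap.id {x // x ∉ A}) (g'.comp f') :=
    { toFun := fun q => ⟨F (q.1, q.2), hF q.1 q.2 q.2.2⟩
      continuous_toFun := by fun_prop
      map_zero_left := fun x => Subtype.ext (hF0 x)
      map_one_left := fun x => Subtype.ext (hF1 x) }
  let G' : ContinuousMap.Homotopy (ContinuousMap.id {y // y ∉ B}) (f'.comp g') :=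
    { toFun := fun q => ⟨G (q.1, q.2), hG q.1 q.2 q.2.2⟩
      continuous_toFun := by fun_prop
      map_zero_left := fun y => Subtype.ext (hG0 y)
      map_one_left := fun y => Subtype.ext (hG1 y) }
  exact ⟨⟨f', g', ⟨F'.symm⟩, ⟨G'.symm⟩⟩⟩

end HomotopyTypes

/-! ### Topology of the cone construction -/

namespace ConeGlue

open unitInterval Topology

variable {X Y : Type u} [TopologicalSpace X] [TopologicalSpace Y]

/-- The quotient map `X × [0,1] → h(X)`. -/
def mk (p : X × UnitI) : ConeGlue X := Quotient.mk (coneSetoid X) p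

theorem mk_eq_mk {p q : X × UnitI} : mk p = mk q ↔ p = q ∨ (p.2 = 1 ∧ q.2 = 1) :=
  Quotient.eq (r := coneSetoid X)

theorem mk_apex (x y : X) : mk (x, 1) = mk (y, 1) := mk_eq_mk.2 (Or.inr ⟨rfl, rfl⟩)

theorem isQuotientMap_mk : IsQuotientMap (mk : X × UnitI → ConeGlue X) := isQuotientMap_quotient_mk'

theorem continuous_mk : Continuous (mk : X × UnitI → ConeGlue X) := isQuotientMap_mk.continuous

/-- Only top points are identified, and `A` contains none of them. -/
theorem mk_mem_image {A : Set (X × UnitI)} (hA : ∀ p ∈ A, p.2 ≠ 1) {p : X × UnitI} :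
    mk p ∈ mk '' A ↔ p ∈ A := by
  refine ⟨?_, fun h => ⟨p, h, rfl⟩⟩
  rintro ⟨q, hq, hqp⟩
  rcases mk_eq_mk.1 hqp with rfl | h
  · exact hq
  · exact absurd h.1 (hA q hq)

/-- Points move up towards the cone point, at a speed prescribed by `l`. -/
def rise (l : C(X, I)) : C(I × ConeGlue X, ConeGlue X) where
  -- The new height is `1 - (1 - t) * (1 - s * l x)`, which keeps `t = 1` at the apex and reaches it
  -- when `s * l x = 1`.
  toFun q := Quotient.liftOn q.2 (fun p => mk (p.1, σ (σ p.2 * σ (q.1 * l p.1)))) (by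
    rintro ⟨x, t⟩ ⟨y, s⟩ (h | ⟨h, h'⟩)
    · rw [h]
    · simp only at h h'
      subst h h'
      simp [mk_apex x y])
  continuous_toFun := by
    -- The parameter interval is locally compact, so its product with the quotient map is again a
    -- quotient map.
    refine isQuotientMap_mk.continuous_lift_prod_right ?_
    change Continuous fun q : I × (X × I) => mk (q.2.1, σ (σ q.2.2 * σ (q.1 * l q.2.1)))
    exact continuous_mk.comp (by fun_prop)

theorem rise_mk (l : C(X, I)) (s : I) (p : X × I) :
    rise l (s, mk p) = mk (p.1, σ (σ p.2 * σ (s * l p.1))) := rfl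

theorem rise_zero (l : C(X, I)) (z : ConeGlue X) : rise l (0, z) = z := by
  obtain ⟨p, rfl⟩ := isQuotientMap_mk.surjective z
  simp [rise_mk]

/-- Over the shadow of `A` the speed is zero, so a point that ends in `A` has not moved. -/
theorem rise_notMem {l : C(X, I)} {A : Set (X × UnitI)} (hA : ∀ p ∈ A, p.2 ≠ 1)
    (hl : ∀ p ∈ A, l p.1 = 0) (s : I) {z : ConeGlue X} (hz : z ∉ mk '' A) :
    rise l (s, z) ∉ mk '' A := by
  obtain ⟨p, rfl⟩ := isQuotientMap_mk.surjective z
  rw [rise_mk, mk_mem_image hA]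
  intro h
  have h0 := hl _ h
  simp only at h0
  apply hz
  rw [mk_mem_image hA]
  simpa [h0] using h

/-- The map of cones induced by a map of bases. -/
def map (f : C(X, Y)) : C(ConeGlue X, ConeGlue Y) where
  toFun := Quotient.lift (fun p => mk (f p.1, p.2)) (by
    rintro ⟨x, t⟩ ⟨y, s⟩ (h | ⟨h, h'⟩)
    · rw [h]
    · simp only at h h'
      subst h h'
      exact mk_apex _ _)
  continuous_toFun := isQuotientMap_mk.continuous_iff.2
    (continuous_mk.comp (f := fun p : X × I => (f p.1, p.2)) (by fun_prop))

theorem map_mk (f : C(X, Y)) (p : X × I) : map f (mk p) = mk (f p.1, p.2) := rfl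

/-- Embedding the base in a larger one does not change the homotopy type of the complement in the
cone of a compact set whose shadow is interior to the image of the embedding. -/
theorem sameHomotopyType_of_isEmbedding [Nonempty X] [CompactSpace Y] [T2Space Y] {f : X → Y}
    (hf : IsEmbedding f) {A : Set (X × UnitI)} (hAc : IsCompact A) (hA : ∀ p ∈ A, p.2 ≠ 1)
    (hnhds : ∀ p ∈ A, range f ∈ 𝓝 (f p.1)) :
    SameHomotopyType {z : ConeGlue X // z ∉ mk '' A}
      {z : ConeGlue Y // z ∉ mk '' (Prod.map f id '' A)} := by
  set B := Prod.map f id '' A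
  have hB : ∀ p ∈ B, p.2 ≠ 1 := by
    rintro _ ⟨p, hp, rfl⟩; exact hA p hp
  have hSc : IsClosed ((fun p => f p.1) '' A) :=
    (hAc.image (hf.continuous.comp continuous_fst)).isClosed
  -- The room between the closure of `W` and the edge of `range f` lets the cutoff reach `1` before
  -- the inverse of `f` stops being continuous.
  obtain ⟨W, hWo, hSW, hWf⟩ := normal_exists_closure_subset hSc (isOpen_interior (s := range f))
    (by rintro _ ⟨p, hp, rfl⟩; exact mem_interior_iff_mem_nhds.2 (hnhds p hp))
  obtain ⟨l₀, hl0, hl1, hl⟩ := exists_continuous_zero_one_of_isClosed hSc hWo.isClosed_compl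
    (disjoint_compl_right_iff_subset.2 hSW)
  let l : C(Y, I) := ⟨fun y => ⟨l₀ y, hl y⟩, by fun_prop⟩
  have hlA : ∀ p ∈ A, l (f p.1) = 0 := fun p hp => Subtype.ext (hl0 ⟨p, hp, rfl⟩)
  have hlB : ∀ p ∈ B, l p.1 = 0 := by
    rintro _ ⟨p, hp, rfl⟩; exact hlA p hp
  have hlW : ∀ y ∉ W, l y = 1 := fun y hy => Subtype.ext (hl1 hy)
  have hlr : ∀ y ∉ range f, l y = 1 := fun y hy =>
    hlW y fun h => hy (interior_subset (hWf (subset_closure h)))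
  let k : Y → X := Function.invFun f
  have hkf : ∀ x, k (f x) = x := Function.leftInverse_invFun hf.injective
  have hfk : ∀ y ∈ range f, f (k y) = y := fun y hy => Function.invFun_eq hy
  have hk : ContinuousOn k (range f) := by
    rw [continuousOn_iff_continuous_domRestrict]
    refine hf.continuous_iff.2 ?_
    have : f ∘ (range f).domRestrict k = Subtype.val := funext fun y => hfk y y.2
    rw [this]
    exact continuous_subtype_val
  -- Off `W` this is the apex, so the arbitrary values of `k` outside `range f` do not matter.
  -- Composed either way with the map induced by `f`, it gives the end of a `rise`.
  let r₀ : Y × I → ConeGlue X := fun p => mk (k p.1, σ (σ p.2 * σ (l p.1)))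
  have hr₀ : Continuous r₀ := by
    rw [continuous_iff_continuousAt]
    rintro ⟨y, t⟩
    by_cases hy : y ∈ closure W
    · have hky : ContinuousAt k y :=
        hk.continuousAt (mem_interior_iff_mem_nhds.1 (hWf hy))
      refine continuous_mk.continuousAt.comp (f := fun p : Y × I => (k p.1, σ (σ p.2 * σ (l p.1))))
        (ContinuousAt.prodMk ?_ (by fun_prop))
      exact ContinuousAt.comp (f := Prod.fst) (x := (y, t)) hky continuousAt_fst
    · have hev : ∀ᶠ p : Y × I in 𝓝 (y, t), p.1 ∈ (closure W)ᶜ :=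
        continuousAt_fst.eventually_mem (isClosed_closure.isOpen_compl.mem_nhds hy)
      refine (continuousAt_const (y := mk (k y, 1))).congr ?_
      filter_upwards [hev] with p hp
      have : l p.1 = 1 := hlW _ fun h => hp (subset_closure h)
      simp only [r₀, this, symm_one, mul_zero, symm_zero]
      exact mk_apex _ _
  let r : C(ConeGlue Y, ConeGlue X) :=
    { toFun := Quotient.lift r₀ (by
        rintro ⟨x, t⟩ ⟨y, s⟩ (h | ⟨h, h'⟩)
        · rw [h]
        · simp only at h h'
          subst h h'
          simp [r₀, mk_apex (k x) (k y)])
      continuous_toFun := isQuotientMap_mk.continuous_iff.2 hr₀ }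
  have hr : ∀ p, r (mk p) = mk (k p.1, σ (σ p.2 * σ (l p.1))) := fun _ => rfl
  refine sameHomotopyType_compl (map ⟨f, hf.continuous⟩) r (rise (l.comp ⟨f, hf.continuous⟩))
    (rise l) ?_ ?_ (fun s z hz => rise_notMem hA hlA s hz) (fun s z hz => rise_notMem hB hlB s hz)
    (rise_zero _) ?_ (rise_zero _) ?_
  · intro z hz
    obtain ⟨p, rfl⟩ := isQuotientMap_mk.surjective z
    rw [map_mk, mk_mem_image hB]
    rintro ⟨q, hq, hqp⟩
    obtain ⟨h1, h2⟩ := Prod.ext_iff.1 hqp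
    have : q = p := Prod.ext (hf.injective h1) h2
    exact hz ⟨p, this ▸ hq, rfl⟩
  · intro z hz
    obtain ⟨p, rfl⟩ := isQuotientMap_mk.surjective z
    rw [hr, mk_mem_image hA]
    intro h
    by_cases hp : p.1 ∈ range f
    · have h0 := hlA _ h
      simp only [hfk _ hp] at h0
      rw [h0, symm_zero, mul_one, symm_symm] at h
      exact hz ⟨p, ⟨_, h, Prod.ext (hfk _ hp) rfl⟩, rfl⟩
    · exact hA _ h (by simp [hlr _ hp])
  · intro z
    obtain ⟨p, rfl⟩ := isQuotientMap_mk.surjective z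
    simp [rise_mk, map_mk, hr, hkf]
  · intro z
    obtain ⟨p, rfl⟩ := isQuotientMap_mk.surjective z
    by_cases hp : p.1 ∈ range f
    · simp [rise_mk, map_mk, hr, hfk _ hp]
    · simp only [rise_mk, map_mk, hr, hlr _ hp, one_mul, symm_one, mul_zero, symm_zero]
      exact mk_apex _ _

/-- Over a contractible base, gluing a cone on the top does not change the homotopy type of the
complement of a compact set that is disjoint from the top. -/
theorem sameHomotopyType_of_contractibleSpace [ContractibleSpace X] {A : Set (X × UnitI)}
    (hAc : IsCompact A) (hA : ∀ p ∈ A, p.2 ≠ 1) :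
    SameHomotopyType {z : ConeGlue X // z ∉ mk '' A} {p : X × UnitI // p ∉ A} := by
  obtain ⟨x₀, ⟨c⟩⟩ := id_nullhomotopic X
  -- The contraction runs to time `θ t` at height `t`: it does nothing at heights met by `A`, and
  -- collapses the top to `x₀`, so it descends to the cone.
  obtain ⟨θ₀, h0, h1, hθ⟩ := exists_continuous_zero_one_of_isClosed
    (hAc.image continuous_snd).isClosed (isClosed_singleton (x := (1 : I)))
    (by rw [disjoint_singleton_right]; rintro ⟨p, hp, hp1⟩; exact hA p hp hp1)
  let θ : C(I, I) := ⟨fun t => ⟨θ₀ t, hθ t⟩, by fun_prop⟩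
  have hθA : ∀ p ∈ A, θ p.2 = 0 := fun p hp => Subtype.ext (h0 ⟨p, hp, rfl⟩)
  have hθ1 : θ 1 = 1 := Subtype.ext (h1 rfl)
  have hc0 : ∀ x, c (0, x) = x := fun x => c.apply_zero x
  have hc1 : ∀ x, c (1, x) = x₀ := fun x => c.apply_one x
  let G : C(I × (X × I), X × I) := ⟨fun q => (c (q.1 * θ q.2.2, q.2.1), q.2.2), by fun_prop⟩
  have hG : ∀ s p, G (s, p) = (c (s * θ p.2, p.1), p.2) := fun _ _ => rfl
  have hGA : ∀ s p, G (s, p) ∈ A → p ∈ A := by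
    intro s p h
    have h2 : θ p.2 = 0 := hθA (G (s, p)) h
    rw [hG, h2, mul_zero, hc0] at h
    exact h
  let j : C(ConeGlue X, X × I) :=
    { toFun := Quotient.lift (fun p => (c (θ p.2, p.1), p.2)) (by
        rintro ⟨x, t⟩ ⟨y, s⟩ (h | ⟨h, h'⟩)
        · rw [h]
        · simp only at h h'
          subst h h'
          simp [hθ1, hc1])
      continuous_toFun := isQuotientMap_mk.continuous_iff.2
        (show Continuous fun p : X × I => (c (θ p.2, p.1), p.2) by fun_prop) }
  have hj : ∀ p, j (mk p) = (c (θ p.2, p.1), p.2) := fun _ => rfl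
  let F : C(I × ConeGlue X, ConeGlue X) :=
    { toFun := fun q => Quotient.liftOn q.2 (fun p => mk (G (q.1, p))) (by
        rintro ⟨x, t⟩ ⟨y, s⟩ (h | ⟨h, h'⟩)
        · rw [h]
        · simp only at h h'
          subst h h'
          exact mk_apex _ _)
      continuous_toFun := isQuotientMap_mk.continuous_lift_prod_right
        (show Continuous fun q : I × (X × I) => mk (G (q.1, q.2)) from
          continuous_mk.comp G.continuous) }
  have hF : ∀ s p, F (s, mk p) = mk (G (s, p)) := fun _ _ => rfl
  refine sameHomotopyType_compl j ⟨mk, continuous_mk⟩ F G ?_ ?_ ?_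
    (fun s p hp h => hp (hGA s p h)) ?_ ?_ ?_ ?_
  · intro z hz h
    obtain ⟨p, rfl⟩ := isQuotientMap_mk.surjective z
    have h' : G (1, p) ∈ A := by rw [hG, one_mul]; exact h
    exact hz ⟨p, hGA 1 p h', rfl⟩
  · intro p hp h
    exact hp ((mk_mem_image hA).1 h)
  · intro s z hz h
    obtain ⟨p, rfl⟩ := isQuotientMap_mk.surjective z
    rw [hF, mk_mem_image hA] at h
    exact hz ⟨p, hGA s p h, rfl⟩
  · intro z
    obtain ⟨p, rfl⟩ := isQuotientMap_mk.surjective z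
    simp [hF, hG, hc0]
  · intro z
    obtain ⟨p, rfl⟩ := isQuotientMap_mk.surjective z
    simp [hF, hG, hj]
  · intro p
    simp [hG, hc0]
  · intro p
    simp [hG, hj]

/-- A homeomorphism of `X × [0,1]` that fixes the top induces a homeomorphism of complements in
the cone. -/
theorem sameHomotopyType_of_homeomorph (Θ : X × UnitI ≃ₜ X × UnitI)
    (hΘ : ∀ p : X × UnitI, p.2 = 1 → Θ p = p) {A B : Set (X × UnitI)} (hAB : Θ '' A = B) :
    SameHomotopyType {z : ConeGlue X // z ∉ mk '' A} {z : ConeGlue X // z ∉ mk '' B} := by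
  have key : ∀ Ξ : X × UnitI ≃ₜ X × UnitI, (∀ p : X × UnitI, p.2 = 1 → Ξ p = p) →
      ∀ p q, (coneSetoid X).r p q → mk (Ξ p) = mk (Ξ q) := by
    rintro Ξ hΞ p q (h | ⟨h, h'⟩)
    · rw [h]
    · rw [hΞ p h, hΞ q h', mk_eq_mk]
      exact Or.inr ⟨h, h'⟩
  have hΘ' : ∀ p : X × UnitI, p.2 = 1 → Θ.symm p = p := fun p hp => by
    rw [Homeomorph.symm_apply_eq, hΘ p hp]
  let T : ConeGlue X ≃ₜ ConeGlue X :=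
    { toFun := Quotient.lift (fun p => mk (Θ p)) (key Θ hΘ)
      invFun := Quotient.lift (fun p => mk (Θ.symm p)) (key Θ.symm hΘ')
      left_inv := fun z => by
        obtain ⟨p, rfl⟩ := isQuotientMap_mk.surjective z
        exact congrArg mk (Θ.symm_apply_apply p)
      right_inv := fun z => by
        obtain ⟨p, rfl⟩ := isQuotientMap_mk.surjective z
        exact congrArg mk (Θ.apply_symm_apply p)
      continuous_toFun := isQuotientMap_mk.continuous_iff.2 (continuous_mk.comp Θ.continuous)
      continuous_invFun :=
        isQuotientMap_mk.continuous_iff.2 (continuous_mk.comp Θ.symm.continuous) }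
  have hT : T '' (mk '' A) = mk '' B := by
    rw [← hAB, image_image, image_image]
    rfl
  refine ⟨(T.subtype fun z => not_congr ?_).toHomotopyEquiv⟩
  rw [← hT, T.injective.mem_set_image]

end ConeGlue

/-! ### Links and isotopies in the thickening -/

namespace CompactBase

variable {n : ℕ} {F : CompactBase.{u} n}

theorem fst_isInteriorPoint {p : F.Thick} (hp : p ∈ F.thickInterior) :
    (𝓡∂ (n + 1)).IsInteriorPoint p.1 := by
  rw [thickInterior, ModelWithCorners.interior_prod] at hp
  exact hp.1

theorem snd_ne_one {p : F.Thick} (hp : p ∈ F.thickInterior) : p.2 ≠ 1 := by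
  rw [thickInterior, ModelWithCorners.interior_prod] at hp
  intro h
  have h1 : (𝓡∂ 1).IsInteriorPoint p.2 := hp.2
  rw [h] at h1
  exact ((𝓡∂ 1).isInteriorPoint_iff_not_isBoundaryPoint _).1 h1 Icc_isBoundaryPoint_top

theorem IsLink.isCompact {L : Set F.Thick} (hL : F.IsLink L) : IsCompact L := by
  obtain ⟨N, _, _, _, _, i, hi, rfl⟩ := hL
  exact isCompact_range hi.smoothEmb.contMDiff.continuous

theorem IsLink.subset_thickInterior {L : Set F.Thick} (hL : F.IsLink L) :
    L ⊆ F.thickInterior := by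
  obtain ⟨N, _, _, _, _, i, hi, rfl⟩ := hL
  exact hi.range_subset

theorem IsDisc.contractibleSpace (hF : F.IsDisc) : ContractibleSpace F := by
  obtain ⟨e, he, hrange⟩ := hF
  have : ContractibleSpace (Metric.closedBall (0 : EuclideanSpace ℝ (Fin (n + 1))) 1) :=
    (convex_closedBall _ _).contractibleSpace (Metric.nonempty_closedBall.2 zero_le_one)
  exact (he.isEmbedding.toHomeomorph.trans (Homeomorph.setCongr hrange)).contractibleSpace

end CompactBase

theorem ThickLink.sameHomotopyType_of_isDisc {n : ℕ} {D : CompactBase.{u} n} (hD : D.IsDisc)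
    (L : ThickLink D) : SameHomotopyType (LinkPair.mk D L).ConeComplement L.Complement := by
  have := hD.contractibleSpace
  exact ConeGlue.sameHomotopyType_of_contractibleSpace L.isLink.isCompact
    fun p hp => CompactBase.snd_ne_one (L.isLink.subset_thickInterior hp)

/-- Isotopic links in `F × [0,1]` are related by a homeomorphism that fixes the top. -/
theorem ThickLink.Isotopic.exists_homeomorph {n : ℕ} {F : CompactBase.{u} n} {L L' : ThickLink F}
    (h : L.Isotopic L') :
    ∃ Θ : F.Thick ≃ₜ F.Thick, (∀ p, p.2 = 1 → Θ p = p) ∧ Θ '' L.carrier = L'.carrier := by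
  obtain ⟨N, _, _, _, _, Φ, hΦ, hemb, h0, h1⟩ := h
  have : T2Space N := (hemb 0).smoothEmb.isEmbedding.t2Space
  -- Reparametrizing by a smooth step extends the isotopy to all real times, constant beyond the
  -- ends, so the time parameter has no boundary.
  let τ : ℝ → UnitI := fun s => projIcc 0 1 zero_le_one (Real.smoothTransition s)
  have hτ : ContMDiff 𝓘(ℝ, ℝ) (𝓡∂ 1) ∞ τ :=
    contMDiffOn_projIcc.comp_contMDiff Real.smoothTransition.contDiff.contMDiff
      fun s => ⟨Real.smoothTransition.nonneg s, Real.smoothTransition.le_one s⟩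
  have hτ0 : τ 0 = 0 := by
    simp only [τ, Real.smoothTransition.zero]
    exact projIcc_left zero_le_one
  have hτ1 : τ 1 = 1 := by
    simp only [τ, Real.smoothTransition.one]
    exact projIcc_right zero_le_one
  have hΨ : ContMDiff ((𝓡 n).prod 𝓘(ℝ, ℝ)) (CompactBase.thickModel n) ∞
      fun q : N × ℝ => Φ (q.1, τ q.2) :=
    hΦ.comp (contMDiff_fst.prodMk (hτ.comp contMDiff_snd))
  have hint : ∀ t x, Φ (x, τ t) ∈ F.thickInterior := fun t x =>
    (hemb (τ t)).range_subset ⟨x, rfl⟩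
  obtain ⟨Θ, hΘ, hΘ'⟩ := exists_homeomorph_of_isotopy hΨ
    (fun t => (hemb (τ t)).smoothEmb.isEmbedding.injective)
    (fun t => (hemb (τ t)).smoothEmb.injective_mfderiv) hint
    (Z := {p : F.Thick | p.2 = 1}) (isClosed_eq continuous_snd continuous_const)
    (fun t x => CompactBase.snd_ne_one (hint t x)) 0 1
  refine ⟨Θ, hΘ, ?_⟩
  rw [← h0, ← h1, ← range_comp]
  congr 1
  funext x
  simpa [hτ0, hτ1] using hΘ' x

/-! ### Invariance under virtual equivalence -/

namespace LinkPair

variable {n : ℕ}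

/-- The link lies over interior points of the smaller base, and `f` covers a neighbourhood of the
image of each of these, which is what the cone comparison requires. -/
theorem EmbedsOnto.sameHomotopyType {P Q : LinkPair.{u} n} (h : P.EmbedsOnto Q) :
    SameHomotopyType P.ConeComplement Q.ConeComplement := by
  obtain ⟨f, hf, hfL⟩ := h
  by_cases hP : Nonempty P.base
  · have hint := P.link.isLink.subset_thickInterior
    have key := ConeGlue.sameHomotopyType_of_isEmbedding hf.isEmbedding P.link.isLink.isCompact
      (fun p hp => CompactBase.snd_ne_one (hint hp))
      (fun p hp => (CompactBase.fst_isInteriorPoint (hint hp)).range_mem_nhds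
        ((hf.contMDiff p.1).of_le (by simp)) (hf.injective_mfderiv p.1))
    rw [hfL] at key
    exact key
  -- The quotient has no apex over an empty base, whereas the cone over a non-empty one is
  -- contractible. As the link meets every component, an empty `P.base` forces `Q.base` to be empty.
  · have hP' : IsEmpty P.base := not_nonempty_iff.1 hP
    have hQ' : IsEmpty Q.base := ⟨fun y => by
      obtain ⟨q, -, hq⟩ := Q.link.meets (y, 0)
      rw [← hfL] at hq
      obtain ⟨p, -, -⟩ := hq
      exact hP'.elim p.1⟩
    have hP2 : IsEmpty P.ConeComplement := ⟨fun z => by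
      obtain ⟨p, -⟩ := ConeGlue.isQuotientMap_mk.surjective z.1
      exact hP'.elim p.1⟩
    have hQ2 : IsEmpty Q.ConeComplement := ⟨fun z => by
      obtain ⟨p, -⟩ := ConeGlue.isQuotientMap_mk.surjective z.1
      exact hQ'.elim p.1⟩
    exact ⟨Homeomorph.empty.toHomotopyEquiv⟩

theorem Move.sameHomotopyType {P Q : LinkPair.{u} n} (h : Move P Q) :
    SameHomotopyType P.ConeComplement Q.ConeComplement := by
  cases h with
  | embed _ _ h => exact h.sameHomotopyType
  | isotopy F L L' h =>
    obtain ⟨Θ, hΘ, hL⟩ := h.exists_homeomorph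
    exact ConeGlue.sameHomotopyType_of_homeomorph Θ hΘ hL

theorem VirtuallyEquivalent.sameHomotopyType {P Q : LinkPair.{u} n}
    (h : P.VirtuallyEquivalent Q) : SameHomotopyType P.ConeComplement Q.ConeComplement := by
  induction h with
  | rel _ _ h => exact h.sameHomotopyType
  | refl P => exact .refl _
  | symm _ _ _ ih => exact ih.symm
  | trans _ _ _ _ _ ih ih' => exact ih.trans ih'

end LinkPair

theorem theorem19 (n : ℕ) :
    -- the homotopy type of `h(F) - L` is invariant under virtual equivalence
    (∀ P Q : LinkPair.{u} n, P.VirtuallyEquivalent Q →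
      SameHomotopyType P.ConeComplement Q.ConeComplement) ∧
    -- for links in `D^{n+1} × [0,1]` it is the homotopy type of the link complement
    (∀ D : CompactBase.{u} n, D.IsDisc → ∀ L : ThickLink D,
      SameHomotopyType (LinkPair.mk D L).ConeComplement L.Complement) ∧
    -- a homotopy invariant of spaces, applied to link complements, extends to virtual links
    (∀ (A : Type v) (inv : TopCat.{u} → A),
      (∀ X Y : TopCat.{u}, SameHomotopyType X Y → inv X = inv Y) →
      ∃ J : VirtualLink.{u} n → A,
        (∀ P : LinkPair.{u} n, J P.toVirtual = inv (TopCat.of P.ConeComplement)) ∧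
        (∀ D : CompactBase.{u} n, D.IsDisc → ∀ L : ThickLink D,
          J (LinkPair.mk D L).toVirtual = inv (TopCat.of L.Complement))) ∧
    -- an invariant of links in the disc that depends only on the homotopy type of the complement
    -- extends to an invariant of virtual links that depends only on that of `h(F) - L`
    (∀ D : CompactBase.{u} n, D.IsDisc → ∀ (A : Type v) [Nonempty A] (inv : ThickLink D → A),
      (∀ L L' : ThickLink D, SameHomotopyType L.Complement L'.Complement → inv L = inv L') →
      ∃ J : VirtualLink.{u} n → A,
        (∀ L : ThickLink D, J (LinkPair.mk D L).toVirtual = inv L) ∧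
        (∀ P Q : LinkPair.{u} n, SameHomotopyType P.ConeComplement Q.ConeComplement →
          J P.toVirtual = J Q.toVirtual)) := by
  have hdisc : ∀ D : CompactBase.{u} n, D.IsDisc → ∀ L : ThickLink D,
      SameHomotopyType (LinkPair.mk D L).ConeComplement L.Complement :=
    fun D hD L => L.sameHomotopyType_of_isDisc hD
  refine ⟨fun P Q h => h.sameHomotopyType, hdisc, fun A inv hinv => ?_,
    fun D hD A _ inv hinv => ?_⟩
  · refine ⟨Quotient.lift (fun P : LinkPair.{u} n => inv (TopCat.of P.ConeComplement))
      fun P Q h => hinv _ _ (LinkPair.VirtuallyEquivalent.sameHomotopyType h), fun _ => rfl,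
      fun D hD L => hinv _ _ (hdisc D hD L)⟩
  · classical
    -- The value is read off from any disc link whose complement has the homotopy type of `h(F) -
    -- L`, the choice being immaterial by the hypothesis on `inv`; where there is none, a fixed
    -- default keeps the dependence on homotopy type alone.
    let J₀ : LinkPair.{u} n → A := fun P =>
      if h : ∃ L : ThickLink D, SameHomotopyType P.ConeComplement L.Complement
      then inv h.choose else Classical.arbitrary A
    have hJ₀ : ∀ (P : LinkPair.{u} n) (L : ThickLink D),
        SameHomotopyType P.ConeComplement L.Complement → J₀ P = inv L := by
      intro P L hL
      have h : ∃ L : ThickLink D, SameHomotopyType P.ConeComplement L.Complement := ⟨L, hL⟩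
      simp only [J₀, dif_pos h]
      exact hinv _ _ (h.choose_spec.symm.trans hL)
    have hJ : ∀ P Q : LinkPair.{u} n, SameHomotopyType P.ConeComplement Q.ConeComplement →
        J₀ P = J₀ Q := by
      intro P Q hPQ
      by_cases h : ∃ L : ThickLink D, SameHomotopyType P.ConeComplement L.Complement
      · obtain ⟨L, hL⟩ := h
        rw [hJ₀ P L hL, hJ₀ Q L (hPQ.symm.trans hL)]
      · have h' : ¬∃ L : ThickLink D, SameHomotopyType Q.ConeComplement L.Complement :=
          fun ⟨L, hL⟩ => h ⟨L, hPQ.trans hL⟩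
        simp only [J₀, dif_neg h, dif_neg h']
    exact ⟨Quotient.lift J₀ fun P Q h => hJ P Q (LinkPair.VirtuallyEquivalent.sameHomotopyType h),
      fun L => hJ₀ _ L (hdisc D hD L), hJ⟩
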